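/- **Theorem (Steiner-type formula).** Let $n\ge 1$, let $B$ be the closed Euclidean unit ball of $\mathbb R^n$, and let $\mathcal H^n$ be Lebesgue measure on $\mathbb R^n$. For a non-empty compact convex set $K\subset\mathbb R^n$, the quermassintegrals $W_0(K),\dots,W_n(K)$ are the coefficients in the polynomial expansion $$\mathcal H^n(K+\rho B)=\sum_{i=0}^n\binom ni W_i(K)\,\rho^i\qquad(\rho\ge 0),$$ and $W_i(\emptyset)=0$. Let $f:\mathbb R^n\to[0,+\infty]$ be not identically zero, quasi-concave (that is, $f((1-\lambda)x_0+\lambda x_1)\ge\min\{f(x_0),f(x_1)\}$ for all $x_0,x_1\in\mathbb R^n$ and $\lambda\in[0,1]$), upper semicontinuous, and such that $f(x)\to 0$ as $\|x\|\to+\infty$. For $i=0,\dots,n$ put $$W_i(f)=\int_0^{+\infty}W_i(\{f\ge t\})\,dt\in[0,+\infty].$$ For $\rho>0$ put $f_\rho(x)=\sup\{f(y):\|y-x\|\le\rho\}$. Then, for every $\rho>0$, $$\int_{\mathbb R^n}f_\rho(x)\,dx=\sum_{i=0}^n\binom ni W_i(f)\,\rho^i,$$ as an equality in $[0,+\infty]$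 (both sides may be $+\infty$). -/

import Mathlib

open MeasureTheory
open scoped ENNReal Pointwise

namespace FunctionalSteiner

/-- `w 0, …, w n` are the coefficients of the polynomial expansion
`ℋⁿ(K + ρ B) = ∑ i, C(n,i) w i ρ ^ i` for all `ρ ≥ 0`, where `B` is the closed Euclidean unit ball.
For bounded `K` all the volumes are finite, so `volume.real` is the genuine Lebesgue measure. -/
def IsSteinerCoeff {n : ℕ} (K : Set (EuclideanSpace ℝ (Fin n))) (w : Fin (n + 1) → ℝ) : Prop :=
  ∀ ρ : ℝ, 0 ≤ ρ →
    volume.real (K + ρ • Metric.closedBall (0 : EuclideanSpace ℝ (Fin n)) 1) =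
      ∑ i : Fin (n + 1), (n.choose i : ℝ) * w i * ρ ^ (i : ℕ)

/-- The coefficients are uniquely determined by the set. -/
theorem IsSteinerCoeff.unique {n : ℕ} {K : Set (EuclideanSpace ℝ (Fin n))}
    {v w : Fin (n + 1) → ℝ} (hv : IsSteinerCoeff K v) (hw : IsSteinerCoeff K w) : v = w := by
  classical
  let P : (Fin (n + 1) → ℝ) → Polynomial ℝ := fun u =>
    ∑ i : Fin (n + 1), Polynomial.C ((n.choose i : ℝ) * u i) * Polynomial.X ^ (i : ℕ)
  have heval : ∀ u ρ, (P u).eval ρ = ∑ i : Fin (n + 1), (n.choose i : ℝ) * u i * ρ ^ (i : ℕ) := by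
    intro u ρ
    simp [P, Polynomial.eval_finsetSum]
  have hcoeff : ∀ u (j : Fin (n + 1)), (P u).coeff j = (n.choose j : ℝ) * u j := by
    intro u j
    simp only [P, Polynomial.finsetSum_coeff, Polynomial.coeff_C_mul, Polynomial.coeff_X_pow]
    rw [Finset.sum_eq_single j]
    · simp
    · intro b _ hb
      have : (j : ℕ) ≠ b := fun h => hb (Fin.ext h.symm)
      simp [this]
    · simp
  have hP : P v = P w := by
    refine Polynomial.eq_of_infinite_eval_eq _ _ ((Set.Ici_infinite (0 : ℝ)).mono ?_)
    intro ρ hρ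
    change (P v).eval ρ = (P w).eval ρ
    rw [heval, heval, ← hv ρ hρ, ← hw ρ hρ]
  funext j
  have h := congrArg (fun p => Polynomial.coeff p (j : ℕ)) hP
  simp only [hcoeff] at h
  have hpos : (n.choose j : ℝ) ≠ 0 :=
    Nat.cast_ne_zero.mpr (Nat.choose_pos (Nat.lt_succ_iff.mp j.2)).ne'
  exact mul_left_cancel₀ hpos h

open Classical in
/-- The `i`-th quermassintegral `W_i(K)`: the `i`-th coefficient in the polynomial expansion of
`ρ ↦ ℋⁿ(K + ρ B)`, with `W_i(∅) = 0`. The value `0` is assigned when there is no such expansion;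
that every convex body has one is not assumed anywhere. -/
noncomputable def quermass {n : ℕ} (i : Fin (n + 1)) (K : Set (EuclideanSpace ℝ (Fin n))) : ℝ :=
  if h : ∃ w : Fin (n + 1) → ℝ, IsSteinerCoeff K w then h.choose i else 0

theorem IsSteinerCoeff.quermass_eq {n : ℕ} {K : Set (EuclideanSpace ℝ (Fin n))}
    {w : Fin (n + 1) → ℝ} (hw : IsSteinerCoeff K w) (i : Fin (n + 1)) : quermass i K = w i := by
  have h : ∃ w : Fin (n + 1) → ℝ, IsSteinerCoeff K w := ⟨w, hw⟩
  rw [quermass, dif_pos h, h.choose_spec.unique hw]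

theorem quermass_empty {n : ℕ} (i : Fin (n + 1)) :
    quermass i (∅ : Set (EuclideanSpace ℝ (Fin n))) = 0 :=
  IsSteinerCoeff.quermass_eq (w := fun _ => 0) (fun ρ _ => by simp) i

/-- The class `𝒬ⁿ` of functions `f : ℝⁿ → [0, +∞]` that are not identically zero, quasi-concave,
upper semicontinuous and vanish at infinity. -/
structure QClass {n : ℕ} (f : EuclideanSpace ℝ (Fin n) → ℝ≥0∞) : Prop where
  ne_zero : f ≠ 0
  quasiconcave : QuasiconcaveOn ℝ Set.univ f
  upperSemicontinuous : UpperSemicontinuous f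
  vanishing : Filter.Tendsto f (Filter.cocompact (EuclideanSpace ℝ (Fin n))) (nhds 0)

/-- The functional quermassintegral `W_i(f) = ∫₀^∞ W_i({f ≥ t}) dt`, with values in `[0, +∞]`. -/
noncomputable def functionalQuermass {n : ℕ} (i : Fin (n + 1))
    (f : EuclideanSpace ℝ (Fin n) → ℝ≥0∞) : ℝ≥0∞ :=
  ∫⁻ t in Set.Ioi (0 : ℝ), ENNReal.ofReal (quermass i {x | ENNReal.ofReal t ≤ f x})

/-- `f_ρ(x) = sup_{y ∈ B_ρ(x)} f(y)`, with `B_ρ(x)` the closed ball. -/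
noncomputable def ballSup {n : ℕ} (ρ : ℝ) (f : EuclideanSpace ℝ (Fin n) → ℝ≥0∞)
    (x : EuclideanSpace ℝ (Fin n)) : ℝ≥0∞ :=
  ⨆ y ∈ Metric.closedBall x ρ, f y

end FunctionalSteiner

/-! Adding a segment `[-ρ v, ρ v]` to a convex body increases its measure by `2 ρ` times the measure
of its projection along `v`; by induction on the number of segments, the measure of `K + ρ Z` is
a polynomial in `ρ` with nonnegative coefficients for every zonotope `Z`. As `∫_B |⟨x, u⟩| dx`
is a multiple of `‖u‖`, the support function of the ball `B` is a limit of support functions of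
zonotopes, and a pointwise limit of polynomials of bounded degree is a polynomial: this gives
the expansion of the measure of `K + ρ B`. The formula for functions follows by integrating over
the superlevel sets, because `{f_ρ ≥ t} = {f ≥ t} + ρ B`. -/

namespace FunctionalSteiner

open Metric Polynomial Filter
open scoped NNReal Topology

section Segment

variable {E F : Type*} [AddCommGroup E] [Module ℝ E] [AddCommGroup F] [Module ℝ F]

theorem image_segment_neg_self (A : E →ₗ[ℝ] F) (v : E) :
    A '' segment ℝ (-v) v = segment ℝ (-A v) (A v) := by
  simpa only [LinearMap.coe_toAffineMap, map_neg] using image_segment ℝ A.toAffineMap (-v) v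

theorem isCompact_segment [TopologicalSpace E] [IsTopologicalAddGroup E] [ContinuousSMul ℝ E]
    (x y : E) : IsCompact (segment ℝ x y) := by
  rw [segment_eq_image]
  exact isCompact_Icc.image (by fun_prop)

end Segment

section Shadow

theorem volume_add_Icc {s : Set ℝ} (hs : IsCompact s) (hc : Convex ℝ s) (hne : s.Nonempty)
    (t : ℝ≥0) : volume (s + Set.Icc (-t : ℝ) t) = volume s + 2 * t := by
  have hle : sInf s ≤ sSup s := Real.sInf_le_sSup s hs.bddBelow hs.bddAbove
  rw [eq_Icc_of_connected_compact ⟨hne, hc.isPreconnected⟩ hs,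
    Set.Icc_add_Icc hle (neg_le_self t.coe_nonneg), Real.volume_Icc, Real.volume_Icc,
    show sSup s + t - (sInf s + -t) = (sSup s - sInf s) + 2 * t by ring,
    ENNReal.ofReal_add (sub_nonneg.mpr hle) (by positivity), ENNReal.ofReal_mul zero_le_two,
    ENNReal.ofReal_ofNat, ENNReal.ofReal_coe_nnreal]

variable {F : Type*}

theorem preimage_prodMk_add_prod_zero [AddGroup F] (S : Set (ℝ × F)) (T : Set ℝ) (y : F) :
    (fun x => (x, y)) ⁻¹' (S + T ×ˢ {0}) = (fun x => (x, y)) ⁻¹' S + T := by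
  ext x
  simp [Set.mem_add]

theorem prod_add_Icc_prod_zero [NormedAddCommGroup F] [NormedSpace ℝ F] [MeasurableSpace F]
    [BorelSpace F] [SecondCountableTopology F] (ν : Measure F) [SFinite ν] {S : Set (ℝ × F)}
    (hS : IsCompact S) (hc : Convex ℝ S) (t : ℝ≥0) :
    (volume.prod ν) (S + Set.Icc (-t : ℝ) t ×ˢ {0}) =
      (volume.prod ν) S + 2 * t * ν (Prod.snd '' S) := by
  have hm : MeasurableSet (Prod.snd '' S) := (hS.image continuous_snd).measurableSet
  rw [Measure.prod_apply_symm (hS.add (isCompact_Icc.prod isCompact_singleton)).measurableSet,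
    Measure.prod_apply_symm hS.measurableSet, ← lintegral_indicator_const hm,
    ← lintegral_add_right _ (measurable_const.indicator hm)]
  refine lintegral_congr fun y => ?_
  rw [preimage_prodMk_add_prod_zero]
  by_cases hy : y ∈ Prod.snd '' S
  · rw [Set.indicator_of_mem hy]
    have hcompact : IsCompact ((fun x : ℝ => (x, y)) ⁻¹' S) := by
      refine (hS.image continuous_fst).of_isClosed_subset (hS.isClosed.preimage (by fun_prop)) ?_
      exact fun x hx => ⟨_, hx, rfl⟩
    have hconvex : Convex ℝ ((fun x : ℝ => (x, y)) ⁻¹' S) := fun a ha b hb p q hp hq hpq => by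
      simpa [← add_smul, hpq] using hc ha hb hp hq hpq
    obtain ⟨⟨a, b⟩, hab, rfl⟩ := hy
    exact volume_add_Icc hcompact hconvex ⟨a, hab⟩ t
  · have hempty : (fun x : ℝ => (x, y)) ⁻¹' S = ∅ :=
      Set.eq_empty_of_forall_notMem fun x hx => hy ⟨_, hx, rfl⟩
    simp only [Set.indicator_of_notMem hy, hempty, Set.empty_add, measure_empty, add_zero]

variable {E : Type*} [NormedAddCommGroup E] [NormedSpace ℝ E] [FiniteDimensional ℝ E]
  [MeasurableSpace E] [BorelSpace E] (μ : Measure E) [μ.IsAddHaarMeasure]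

theorem exists_measurePreserving_prod {v : E} (hv : v ≠ 0) :
    ∃ (F : Submodule ℝ E) (A : E ≃L[ℝ] ℝ × F) (ν : Measure F),
      A v = (1, 0) ∧ ν.IsAddHaarMeasure ∧ MeasurePreserving A μ (volume.prod ν) := by
  obtain ⟨φ, hφ⟩ := SeparatingDual.exists_eq_one (R := ℝ) hv
  let A : E ≃L[ℝ] ℝ × φ.ker := .equivOfRightInverse φ (.toSpanSingleton ℝ v) fun t => by simp [hφ]
  have hμA : (μ.map A).IsAddHaarMeasure := A.isAddHaarMeasure_map μ
  let ν₀ : Measure φ.ker := Measure.addHaar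
  -- `A` maps `μ` to a multiple of `volume.prod ν₀`; the constant is absorbed into `ν₀`.
  let c := (μ.map A).addHaarScalarFactor (volume.prod ν₀)
  have hc : c ≠ 0 := (Measure.addHaarScalarFactor_pos_of_isAddHaarMeasure _ _).ne'
  refine ⟨φ.ker, A, c • ν₀, ?_, .nnreal_smul ν₀ hc, A.continuous.measurable, ?_⟩
  · ext <;> simp [A, hφ]
  · rw [Measure.prod_smul_right]
    exact Measure.isAddLeftInvariant_eq_smul _ _

theorem exists_measure_add_segment {v : E} (hv : v ≠ 0) :
    ∃ (F : Submodule ℝ E) (π : E →L[ℝ] F) (ν : Measure F),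
      Module.finrank ℝ F + 1 = Module.finrank ℝ E ∧ ν.IsAddHaarMeasure ∧
        ∀ K : Set E, IsCompact K → Convex ℝ K → ∀ t : ℝ≥0,
          μ (K + segment ℝ (-((t : ℝ) • v)) ((t : ℝ) • v)) = μ K + 2 * t * ν (π '' K) := by
  obtain ⟨F, A, ν, hAv, hν, hA⟩ := exists_measurePreserving_prod μ hv
  refine ⟨F, (ContinuousLinearMap.snd ℝ ℝ F).comp A.toContinuousLinearMap, ν, ?_, hν,
    fun K hK hc t => ?_⟩
  · simpa [add_comm] using A.toLinearEquiv.finrank_eq.symm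
  have hμ (S : Set E) : μ S = (volume.prod ν) (A '' S) := by
    have := hA.measure_preimage_emb A.toHomeomorph.measurableEmbedding (A '' S)
    rwa [A.injective.preimage_image] at this
  have hseg : A '' segment ℝ (-((t : ℝ) • v)) ((t : ℝ) • v) = Set.Icc (-t : ℝ) t ×ˢ {0} := by
    have h := image_segment_neg_self A.toLinearMap ((t : ℝ) • v)
    have h' := Prod.image_mk_segment_left (𝕜 := ℝ) (-t : ℝ) t (0 : F)
    rw [segment_eq_Icc (neg_le_self t.coe_nonneg)] at h'
    rw [Set.prod_singleton, h']
    simpa [hAv] using h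
  rw [hμ, Set.image_add, hseg, prod_add_Icc_prod_zero ν (hK.image A.continuous)
    (hc.linear_image A.toLinearMap), ← hμ, Set.image_image]
  rfl

end Shadow

/-- The centrally symmetric zonotope with generators `v i`, `i ∈ s`: the Minkowski sum of the
segments `[-v i, v i]`. The Steiner polynomial is constructed for zonotopes first, the unit ball
being a limit of zonotopes. Generators are an indexed family, so that a linear map `A` acts by
`A ∘ v` even when it identifies some of them; the empty sum is `{0}`. -/
def zonotope {ι E : Type*} [AddCommGroup E] [Module ℝ E] (s : Finset ι) (v : ι → E) : Set E :=
  ∑ i ∈ s, segment ℝ (-v i) (v i)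

section Zonotope

variable {ι : Type*} (s : Finset ι)

section Module

variable {E F : Type*} [AddCommGroup E] [Module ℝ E] [AddCommGroup F] [Module ℝ F] (v : ι → E)

theorem convex_zonotope : Convex ℝ (zonotope s v) :=
  convex_sum _ fun _ _ => convex_segment _ _

theorem image_zonotope (A : E →ₗ[ℝ] F) : A '' zonotope s v = zonotope s (A ∘ v) := by
  simp only [zonotope, Set.image_finsetSum, image_segment_neg_self, Function.comp_apply]

theorem smul_zonotope (ρ : ℝ) : ρ • zonotope s v = zonotope s (ρ • v) :=
  image_zonotope s v (LinearMap.lsmul ℝ E ρ)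

theorem isCompact_zonotope [TopologicalSpace E] [IsTopologicalAddGroup E] [ContinuousSMul ℝ E] :
    IsCompact (zonotope s v) :=
  Finset.sum_induction _ IsCompact (fun _ _ => IsCompact.add) isCompact_singleton
    fun _ _ => isCompact_segment _ _

end Module

theorem exists_polynomial_measure_add_zonotope {E : Type*} [NormedAddCommGroup E]
    [NormedSpace ℝ E] [FiniteDimensional ℝ E] [MeasurableSpace E] [BorelSpace E] (μ : Measure E)
    [μ.IsAddHaarMeasure] (v : ι → E) {K : Set E} (hK : IsCompact K) (hc : Convex ℝ K) :
    ∃ p : ℝ≥0[X], p.natDegree ≤ Module.finrank ℝ E ∧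
      ∀ ρ : ℝ≥0, μ (K + zonotope s ((ρ : ℝ) • v)) = p.eval ρ := by
  classical
  induction s using Finset.induction_on generalizing E with
  | empty =>
    refine ⟨C (μ K).toNNReal, by simp, fun ρ => ?_⟩
    rw [zonotope, Finset.sum_empty, add_zero, eval_C, ENNReal.coe_toNNReal hK.measure_ne_top]
  | insert i s hi ih =>
    obtain ⟨p, hpdeg, hp⟩ := ih μ v hK hc
    have hinsert (ρ : ℝ≥0) : K + zonotope (insert i s) ((ρ : ℝ) • v) =
        K + zonotope s ((ρ : ℝ) • v) + segment ℝ (-((ρ : ℝ) • v i)) ((ρ : ℝ) • v i) := by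
      rw [zonotope, Finset.sum_insert hi, add_comm (segment ℝ _ _), ← add_assoc]
      rfl
    rcases eq_or_ne (v i) 0 with hvi | hvi
    · refine ⟨p, hpdeg, fun ρ => ?_⟩
      rw [hinsert, hvi, smul_zero, neg_zero, segment_same, Set.singleton_zero, add_zero, hp]
    obtain ⟨F, π, ν, hF, hν, hμ⟩ := exists_measure_add_segment μ hvi
    obtain ⟨q, hqdeg, hq⟩ := ih ν (π ∘ v) (hK.image π.continuous) (hc.linear_image π.toLinearMap)
    refine ⟨p + C 2 * X * q, ?_, fun ρ => ?_⟩
    · compute_degree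
      omega
    have hproj : π '' (K + zonotope s ((ρ : ℝ) • v)) =
        π '' K + zonotope s ((ρ : ℝ) • (π ∘ v)) := by
      rw [Set.image_add, show π ∘ v = π.toLinearMap ∘ v from rfl, ← smul_zonotope,
        ← smul_zonotope, ← image_zonotope, ← image_smul_set]
      rfl
    rw [hinsert, hμ _ (hK.add (isCompact_zonotope s _)) (hc.add (convex_zonotope s _)), hproj,
      hp, hq]
    simp

section InnerProduct

variable {E : Type*} [NormedAddCommGroup E] [InnerProductSpace ℝ E] {s : Finset ι} {v : ι → E}

theorem inner_le_sum_abs_inner_of_mem_zonotope {z : E} (hz : z ∈ zonotope s v) (u : E) :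
    inner ℝ z u ≤ ∑ i ∈ s, |inner ℝ (v i) u| := by
  obtain ⟨g, hg, rfl⟩ := (Set.mem_finsetSum _ _ _).mp hz
  rw [sum_inner]
  refine Finset.sum_le_sum fun i hi => ?_
  have hconvex : Convex ℝ {x : E | inner ℝ x u ≤ |inner ℝ (v i) u|} :=
    convex_halfSpace_le ((innerₗ E).flip u).isLinear _
  refine hconvex.segment_subset ?_ (le_abs_self (inner ℝ (v i) u)) (hg hi)
  rw [Set.mem_ofPred_eq, inner_neg_left]
  exact neg_le_abs _

theorem exists_mem_zonotope_inner_eq_sum_abs_inner (s : Finset ι) (v : ι → E) (u : E) :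
    ∃ z ∈ zonotope s v, inner ℝ z u = ∑ i ∈ s, |inner ℝ (v i) u| := by
  have hvertex (i : ι) : ∃ x ∈ segment ℝ (-v i) (v i), inner ℝ x u = |inner ℝ (v i) u| := by
    rcases abs_choice (inner ℝ (v i) u) with h | h
    · exact ⟨v i, right_mem_segment ℝ _ _, h.symm⟩
    · exact ⟨-v i, left_mem_segment ℝ _ _, by rw [h, inner_neg_left]⟩
  choose g hg hgu using hvertex
  refine ⟨∑ i ∈ s, g i, Set.finsetSum_mem_finsetSum _ _ _ fun i _ => hg i, ?_⟩
  simp only [sum_inner, hgu]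

theorem zonotope_subset_closedBall {r : ℝ} (hr : 0 ≤ r)
    (h : ∀ u : E, ∑ i ∈ s, |inner ℝ (v i) u| ≤ r * ‖u‖) : zonotope s v ⊆ closedBall 0 r := by
  intro z hz
  have hz' := (inner_le_sum_abs_inner_of_mem_zonotope hz z).trans (h z)
  rw [real_inner_self_eq_norm_mul_norm] at hz'
  rw [mem_closedBall_zero_iff]
  rcases (norm_nonneg z).eq_or_lt with h0 | h0
  · rwa [← h0]
  · exact le_of_mul_le_mul_right hz' h0

theorem closedBall_subset_zonotope [CompleteSpace E] {r : ℝ}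
    (h : ∀ u : E, r * ‖u‖ ≤ ∑ i ∈ s, |inner ℝ (v i) u|) : closedBall 0 r ⊆ zonotope s v := by
  intro x hx
  by_contra hxz
  obtain ⟨φ, a, hφz, hφx⟩ := geometric_hahn_banach_closed_point (convex_zonotope s v)
    (isCompact_zonotope s v).isClosed hxz
  obtain ⟨u, rfl⟩ := (InnerProductSpace.toDual ℝ E).surjective φ
  simp only [InnerProductSpace.toDual_apply_apply] at hφz hφx
  obtain ⟨z, hz, hzu⟩ := exists_mem_zonotope_inner_eq_sum_abs_inner s v u
  have hlt : inner ℝ u z < inner ℝ u x := (hφz z hz).trans hφx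
  have hle : inner ℝ u x ≤ inner ℝ u z := calc
    inner ℝ u x ≤ ‖u‖ * ‖x‖ := real_inner_le_norm u x
    _ ≤ ‖u‖ * r := by gcongr; exact mem_closedBall_zero_iff.mp hx
    _ = r * ‖u‖ := mul_comm _ _
    _ ≤ ∑ i ∈ s, |inner ℝ (v i) u| := h u
    _ = inner ℝ u z := by rw [← hzu, real_inner_comm]
  exact hlt.not_ge hle

end InnerProduct

end Zonotope

section Ball

variable {E : Type*} [NormedAddCommGroup E] [InnerProductSpace ℝ E]

theorem abs_integral_abs_inner_sub_le {α : Type*} [MeasurableSpace α] {μ : Measure α} {X Y : α → E}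
    (hX : Integrable X μ) (hY : Integrable Y μ) (u : E) :
    |∫ a, |inner ℝ (X a) u| ∂μ - ∫ a, |inner ℝ (Y a) u| ∂μ| ≤ (∫ a, ‖X a - Y a‖ ∂μ) * ‖u‖ := by
  have hXu : Integrable (fun a => |inner ℝ (X a) u|) μ := (hX.inner_const u).abs
  have hYu : Integrable (fun a => |inner ℝ (Y a) u|) μ := (hY.inner_const u).abs
  rw [← integral_sub hXu hYu, ← integral_mul_const]
  refine abs_integral_le_integral_abs.trans <|
    integral_mono (hXu.sub hYu).abs ((hX.sub hY).norm.mul_const ‖u‖) fun a => ?_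
  calc |(|inner ℝ (X a) u| - |inner ℝ (Y a) u|)|
      ≤ |inner ℝ (X a - Y a) u| := by
        rw [inner_sub_left]
        exact abs_abs_sub_abs_le _ _
    _ ≤ ‖X a - Y a‖ * ‖u‖ := abs_real_inner_le_norm _ _

theorem exists_finset_abs_sum_abs_inner_sub_integral_le {α : Type*} [MeasurableSpace α]
    {μ : Measure α} {X : α → E} (hX : Integrable X μ) {δ : ℝ} (hδ : 0 < δ) :
    ∃ (s : Finset E) (v : E → E), ∀ u : E,
      |∑ y ∈ s, |inner ℝ (v y) u| - ∫ a, |inner ℝ (X a) u| ∂μ| ≤ δ * ‖u‖ := by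
  obtain ⟨Y, hXY, hY⟩ := (memLp_one_iff_integrable.mpr hX).exists_simpleFunc_eLpNorm_sub_lt
    ENNReal.one_ne_top (ENNReal.ofReal_pos.mpr hδ).ne'
  rw [memLp_one_iff_integrable] at hY
  have hdist : ∫ a, ‖Y a - X a‖ ∂μ ≤ δ := by
    simp_rw [norm_sub_rev (Y _)]
    rw [eLpNorm_one_eq_lintegral_enorm] at hXY
    exact (integral_norm_eq_lintegral_enorm (hX.sub hY).aestronglyMeasurable).trans_le
      (ENNReal.toReal_le_of_le_ofReal hδ.le hXY.le)
  refine ⟨Y.range, fun y => μ.real (Y ⁻¹' {y}) • y, fun u => ?_⟩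
  have hsum : ∑ y ∈ Y.range, |inner ℝ (μ.real (Y ⁻¹' {y}) • y) u| =
      ∫ a, |inner ℝ (Y a) u| ∂μ := by
    rw [show (fun a => |inner ℝ (Y a) u|) = Y.map fun y => |inner ℝ y u| from rfl,
      ← SimpleFunc.integral_eq_integral _ (hY.inner_const u).abs,
      SimpleFunc.map_integral Y _ hY (by simp)]
    simp only [real_inner_smul_left, abs_mul, abs_of_nonneg measureReal_nonneg, smul_eq_mul]
  rw [hsum]
  exact (abs_integral_abs_inner_sub_le hY hX u).trans (by gcongr)

variable [FiniteDimensional ℝ E] [MeasurableSpace E] [BorelSpace E]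

theorem integrableOn_id_closedBall (r : ℝ) :
    IntegrableOn (fun x : E => x) (closedBall 0 r) :=
  continuous_id.continuousOn.integrableOn_compact (isCompact_closedBall _ _)

theorem setIntegral_abs_inner_eq_of_norm_eq (r : ℝ) {u w : E} (h : ‖u‖ = ‖w‖) :
    ∫ x in closedBall (0 : E) r, |inner ℝ x u| = ∫ x in closedBall (0 : E) r, |inner ℝ x w| := by
  -- The reflection in the bisector of `u` and `w` swaps them and preserves the ball.
  let R := (Submodule.span ℝ {u - w})ᗮ.reflection
  have hR : R u = w := Submodule.reflection_sub h
  have hball : R ⁻¹' closedBall (0 : E) r = closedBall 0 r := by simp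
  calc ∫ x in closedBall (0 : E) r, |inner ℝ x u|
      = ∫ x in R ⁻¹' closedBall 0 r, |inner ℝ (R x) w| := by
        simp only [hball, ← hR, R.inner_map_map]
    _ = ∫ x in closedBall (0 : E) r, |inner ℝ x w| :=
        R.measurePreserving.setIntegral_preimage_emb R.toHomeomorph.measurableEmbedding
          (fun x => |inner ℝ x w|) _

theorem exists_setIntegral_abs_inner_eq_mul_norm {r : ℝ} (hr : 0 < r) :
    ∃ c : ℝ, 0 < c ∧ ∀ u : E, ∫ x in closedBall (0 : E) r, |inner ℝ x u| = c * ‖u‖ := by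
  rcases subsingleton_or_nontrivial E with hE | hE
  · exact ⟨1, one_pos, fun u => by simp [Subsingleton.elim u 0]⟩
  obtain ⟨e, he⟩ := exists_norm_eq E zero_le_one
  refine ⟨∫ x in closedBall (0 : E) r, |inner ℝ x e|, ?_, fun u => ?_⟩
  · rw [setIntegral_pos_iff_support_of_nonneg_ae (ae_of_all _ fun x => abs_nonneg _)
      ((integrableOn_id_closedBall r).inner_const e).abs]
    have hopen : IsOpen (Function.support (fun x : E => |inner ℝ x e|) ∩ ball 0 r) :=
      (by fun_prop : Continuous fun x : E => |inner ℝ x e|).isOpen_support.inter isOpen_ball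
    refine (hopen.measure_pos volume ⟨(r / 2) • e, ?_, ?_⟩).trans_le
      (measure_mono (Set.inter_subset_inter_right _ ball_subset_closedBall))
    · simp [real_inner_smul_left, he, hr.ne']
    · rw [mem_ball_zero_iff, norm_smul, he, mul_one, Real.norm_of_nonneg (by positivity)]
      exact half_lt_self hr
  · have hu : ‖u‖ = ‖‖u‖ • e‖ := by rw [norm_smul, he, norm_norm, mul_one]
    rw [setIntegral_abs_inner_eq_of_norm_eq r hu, mul_comm, ← integral_const_mul]
    simp only [real_inner_smul_right, abs_mul, abs_norm]

theorem exists_zonotope_between_closedBall (E : Type*) [NormedAddCommGroup E]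
    [InnerProductSpace ℝ E] [FiniteDimensional ℝ E] {ε : ℝ} (hε : 0 < ε) :
    ∃ (s : Finset E) (v : E → E),
      closedBall 0 1 ⊆ zonotope s v ∧ zonotope s v ⊆ closedBall 0 (1 + ε) := by
  borelize E
  obtain ⟨c, hc, hcu⟩ := exists_setIntegral_abs_inner_eq_mul_norm (E := E) one_pos
  obtain ⟨δ, hδ, hδc, hδε⟩ : ∃ δ, 0 < δ ∧ δ < c ∧ c + δ = (1 + ε) * (c - δ) :=
    ⟨c * ε / (2 + ε), by positivity, by rw [div_lt_iff₀] <;> nlinarith, by field_simp; ring⟩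
  obtain ⟨s, v, hsv⟩ :=
    exists_finset_abs_sum_abs_inner_sub_integral_le (integrableOn_id_closedBall (E := E) 1) hδ
  have hcδ : 0 < c - δ := sub_pos.mpr hδc
  have hsum (u : E) : ∑ i ∈ s, |inner ℝ (((c - δ)⁻¹ • v) i) u| =
      (∑ i ∈ s, |inner ℝ (v i) u|) / (c - δ) := by
    simp only [Pi.smul_apply, real_inner_smul_left, abs_mul, ← Finset.mul_sum,
      abs_of_pos (inv_pos.mpr hcδ), div_eq_inv_mul]
  simp only [hcu, abs_sub_le_iff] at hsv
  refine ⟨s, (c - δ)⁻¹ • v, closedBall_subset_zonotope fun u => ?_,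
    zonotope_subset_closedBall (by positivity) fun u => ?_⟩
  · rw [hsum, le_div_iff₀ hcδ]
    linarith [(hsv u).2]
  · rw [hsum, div_le_iff₀ hcδ, mul_right_comm, ← hδε]
    linarith [(hsv u).1]

end Ball

section Limit

/-- The coefficient of `X ^ i` in the `j`-th Lagrange basis polynomial for the nodes `0, …, n`: the
weight of the value at `j` in the `i`-th coefficient of a polynomial of degree at most `n`. It makes
coefficients continuous and measurable functions of finitely many values. -/
noncomputable def lagrangeCoeff (R : Type*) [Field R] (n i j : ℕ) : R :=
  (Lagrange.basis (Finset.range (n + 1)) (Nat.cast : ℕ → R) j).coeff i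

theorem coeff_eq_sum_eval_natCast {R : Type*} [Field R] [CharZero R] {n : ℕ} {p : R[X]}
    (hp : p.natDegree ≤ n) (i : ℕ) :
    p.coeff i = ∑ j ∈ Finset.range (n + 1), p.eval (j : R) * lagrangeCoeff R n i j := by
  have hdeg : p.degree < (Finset.range (n + 1)).card := by
    rw [Finset.card_range]
    exact degree_le_natDegree.trans_lt (by exact_mod_cast Nat.lt_succ_of_le hp)
  conv_lhs => rw [Lagrange.eq_interpolate Nat.cast_injective.injOn hdeg]
  rw [Lagrange.interpolate_apply, finsetSum_coeff]
  simp only [coeff_C_mul, lagrangeCoeff]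

theorem coe_coeff_eq_sum_eval_natCast {n : ℕ} {p : ℝ≥0[X]} (hp : p.natDegree ≤ n) (i : ℕ) :
    (p.coeff i : ℝ) = ∑ j ∈ Finset.range (n + 1),
      ((p.eval (j : ℝ≥0) : ℝ≥0) : ℝ) * lagrangeCoeff ℝ n i j := by
  have heval (j : ℕ) : (p.map NNReal.toRealHom).eval (j : ℝ) = p.eval (j : ℝ≥0) :=
    eval_natCast_map NNReal.toRealHom p j
  simpa only [heval, coeff_map, NNReal.coe_toRealHom] using
    coeff_eq_sum_eval_natCast (natDegree_map_le.trans hp : (p.map NNReal.toRealHom).natDegree ≤ n) i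

theorem exists_polynomial_eval_eq_of_tendsto {α : Type*} {l : Filter α} [l.NeBot] {n : ℕ}
    {p : α → ℝ≥0[X]} (hp : ∀ a, (p a).natDegree ≤ n) {g : ℝ≥0 → ℝ≥0}
    (hg : ∀ x, Tendsto (fun a => (p a).eval x) l (𝓝 (g x))) :
    ∃ q : ℝ≥0[X], q.natDegree ≤ n ∧ ∀ x, q.eval x = g x := by
  have hcoeff (i : ℕ) : ∃ b : ℝ≥0, Tendsto (fun a => (p a).coeff i) l (𝓝 b) := by
    let b := ∑ j ∈ Finset.range (n + 1), (g j : ℝ) * lagrangeCoeff ℝ n i j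
    have hb : Tendsto (fun a => ((p a).coeff i : ℝ)) l (𝓝 b) := by
      simp only [coe_coeff_eq_sum_eval_natCast (hp _)]
      exact tendsto_finsetSum _ fun j _ => (NNReal.tendsto_coe.mpr (hg j)).mul_const _
    exact ⟨⟨b, ge_of_tendsto' hb fun a => NNReal.coe_nonneg _⟩, NNReal.tendsto_coe.mp hb⟩
  choose b hb using hcoeff
  refine ⟨∑ i ∈ Finset.range (n + 1), C (b i) * X ^ i, ?_, fun x => ?_⟩
  · exact natDegree_sum_le_of_forall_le _ _ fun i hi =>
      (natDegree_C_mul_X_pow_le _ _).trans (Nat.lt_succ_iff.mp (Finset.mem_range.mp hi))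
  · refine tendsto_nhds_unique ?_ (hg x)
    simp only [eval_finsetSum, eval_C_mul, eval_X_pow,
      eval_eq_sum_range' (Nat.lt_succ_of_le (hp _))]
    exact tendsto_finsetSum _ fun i _ => (hb i).mul_const _

theorem tendsto_measure_add_smul_of_closedBall_subset {E : Type*} [NormedAddCommGroup E]
    [NormedSpace ℝ E] [ProperSpace E] [MeasurableSpace E] [BorelSpace E] {μ : Measure E}
    [IsFiniteMeasureOnCompacts μ] {α : Type*} {l : Filter α} {ε : α → ℝ} {Z : α → Set E}
    (hε₀ : ∀ a, 0 ≤ ε a) (hε : Tendsto ε l (𝓝 0)) (hZ : ∀ a, closedBall 0 1 ⊆ Z a)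
    (hZ' : ∀ a, Z a ⊆ closedBall 0 (1 + ε a)) {K : Set E} (hK : IsCompact K) (ρ : ℝ≥0) :
    Tendsto (fun a => μ (K + (ρ : ℝ) • Z a)) l
      (𝓝 (μ (K + (ρ : ℝ) • closedBall (0 : E) 1))) := by
  have hKρ : IsCompact (K + (ρ : ℝ) • closedBall (0 : E) 1) :=
    hK.add ((isCompact_closedBall 0 1).smul (ρ : ℝ))
  have hupper (a : α) :
      K + (ρ : ℝ) • Z a ⊆ cthickening (ρ * ε a) (K + (ρ : ℝ) • closedBall (0 : E) 1) := calc
    K + (ρ : ℝ) • Z a ⊆ K + (ρ : ℝ) • closedBall (0 : E) (1 + ε a) :=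
      Set.add_subset_add_left (Set.smul_set_mono (hZ' a))
    _ = K + (ρ : ℝ) • closedBall (0 : E) 1 + (ρ : ℝ) • closedBall (0 : E) (ε a) := by
      rw [add_assoc, ← smul_add, closedBall_add_closedBall zero_le_one (hε₀ a), add_zero]
    _ = cthickening (ρ * ε a) (K + (ρ : ℝ) • closedBall (0 : E) 1) := by
      rw [smul_closedBall _ _ (hε₀ a), smul_zero, NNReal.norm_eq,
        hKρ.add_closedBall_zero (mul_nonneg ρ.coe_nonneg (hε₀ a))]
  have hρε : Tendsto (fun a => ρ * ε a) l (𝓝 0) := by simpa using hε.const_mul (ρ : ℝ)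
  exact tendsto_of_tendsto_of_tendsto_of_le_of_le tendsto_const_nhds
    ((tendsto_measure_cthickening_of_isCompact hKρ).comp hρε)
    (fun a => measure_mono (Set.add_subset_add_left (Set.smul_set_mono (hZ a))))
    fun a => measure_mono (hupper a)

theorem exists_polynomial_measure_add_closedBall {E : Type*} [NormedAddCommGroup E]
    [InnerProductSpace ℝ E] [FiniteDimensional ℝ E] [MeasurableSpace E] [BorelSpace E]
    (μ : Measure E) [μ.IsAddHaarMeasure] {K : Set E} (hK : IsCompact K) (hc : Convex ℝ K) :
    ∃ p : ℝ≥0[X], p.natDegree ≤ Module.finrank ℝ E ∧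
      ∀ ρ : ℝ≥0, μ (K + (ρ : ℝ) • closedBall (0 : E) 1) = p.eval ρ := by
  choose s v hsv hsv' using fun N : ℕ =>
    exists_zonotope_between_closedBall E (Nat.one_div_pos_of_nat (α := ℝ) (n := N))
  choose p hpdeg hp using fun N => exists_polynomial_measure_add_zonotope (s N) μ (v N) hK hc
  have hfinite (ρ : ℝ≥0) : μ (K + (ρ : ℝ) • closedBall (0 : E) 1) ≠ ∞ :=
    (hK.add ((isCompact_closedBall 0 1).smul (ρ : ℝ))).measure_ne_top
  have hlim (ρ : ℝ≥0) : Tendsto (fun N => (p N).eval ρ) atTop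
      (𝓝 (μ (K + (ρ : ℝ) • closedBall (0 : E) 1)).toNNReal) := by
    rw [← ENNReal.tendsto_coe, ENNReal.coe_toNNReal (hfinite ρ)]
    simp only [← hp, ← smul_zonotope]
    exact tendsto_measure_add_smul_of_closedBall_subset (fun N => Nat.one_div_pos_of_nat.le)
      tendsto_one_div_add_atTop_nhds_zero_nat hsv hsv' hK ρ
  obtain ⟨q, hqdeg, hq⟩ := exists_polynomial_eval_eq_of_tendsto hpdeg hlim
  exact ⟨q, hqdeg, fun ρ => by rw [hq, ENNReal.coe_toNNReal (hfinite ρ)]⟩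

end Limit

section Quermass

variable {n : ℕ} {K : Set (EuclideanSpace ℝ (Fin n))}

theorem isSteinerCoeff_coeff_div_choose {p : ℝ≥0[X]} (hpdeg : p.natDegree ≤ n)
    (hp : ∀ ρ : ℝ≥0, volume (K + (ρ : ℝ) • closedBall 0 1) = p.eval ρ) :
    IsSteinerCoeff K fun i => p.coeff i / n.choose i := by
  intro ρ hρ
  lift ρ to ℝ≥0 using hρ
  rw [measureReal_def, hp, ENNReal.coe_toReal, eval_eq_sum_range' (Nat.lt_succ_of_le hpdeg),
    ← Fin.sum_univ_eq_sum_range (fun i => p.coeff i * ρ ^ i)]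
  push_cast
  refine Finset.sum_congr rfl fun i _ => ?_
  have hchoose : (n.choose i : ℝ) ≠ 0 := by exact_mod_cast (Nat.choose_pos i.is_le).ne'
  rw [mul_div_cancel₀ _ hchoose]

theorem exists_polynomial_quermass_eq_coeff_div_choose (hK : IsCompact K) (hc : Convex ℝ K) :
    ∃ p : ℝ≥0[X], p.natDegree ≤ n ∧
      (∀ ρ : ℝ≥0, volume (K + (ρ : ℝ) • closedBall 0 1) = p.eval ρ) ∧
        ∀ i : Fin (n + 1), quermass i K = p.coeff i / n.choose i := by
  obtain ⟨p, hpdeg, hp⟩ := exists_polynomial_measure_add_closedBall volume hK hc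
  rw [finrank_euclideanSpace_fin] at hpdeg
  exact ⟨p, hpdeg, hp, (isSteinerCoeff_coeff_div_choose hpdeg hp).quermass_eq⟩

theorem volume_add_smul_closedBall_eq_sum (hK : IsCompact K) (hc : Convex ℝ K) {ρ : ℝ}
    (hρ : 0 ≤ ρ) :
    volume (K + ρ • closedBall 0 1) =
      ∑ i : Fin (n + 1),
        (n.choose i : ℝ≥0∞) * ENNReal.ofReal (quermass i K) * ENNReal.ofReal ρ ^ (i : ℕ) := by
  obtain ⟨p, hpdeg, hp, hq⟩ := exists_polynomial_quermass_eq_coeff_div_choose hK hc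
  lift ρ to ℝ≥0 using hρ
  rw [hp, eval_eq_sum_range' (Nat.lt_succ_of_le hpdeg),
    ← Fin.sum_univ_eq_sum_range (fun i => p.coeff i * ρ ^ i), ENNReal.ofNNReal_finsetSum]
  refine Finset.sum_congr rfl fun i _ => ?_
  have hchoose : (n.choose i : ℝ≥0) ≠ 0 := by exact_mod_cast (Nat.choose_pos i.is_le).ne'
  rw [hq, ← NNReal.coe_natCast, ← NNReal.coe_div, ENNReal.ofReal_coe_nnreal,
    ENNReal.ofReal_coe_nnreal, ← ENNReal.coe_natCast, ← ENNReal.coe_mul,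
    mul_div_cancel₀ _ hchoose, ENNReal.coe_mul, ENNReal.coe_pow]

theorem quermass_eq_sum_volume (hK : IsCompact K) (hc : Convex ℝ K) (i : Fin (n + 1)) :
    quermass i K = (∑ j ∈ Finset.range (n + 1),
      volume.real (K + (j : ℝ) • closedBall 0 1) * lagrangeCoeff ℝ n i j) / n.choose i := by
  obtain ⟨p, hpdeg, hp, hq⟩ := exists_polynomial_quermass_eq_coeff_div_choose hK hc
  have hvol (j : ℕ) : volume.real (K + (j : ℝ) • closedBall 0 1) = p.eval (j : ℝ≥0) := by
    rw [measureReal_def, ← NNReal.coe_natCast, hp, ENNReal.coe_toReal]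
  simp only [hq, hvol, coe_coeff_eq_sum_eval_natCast hpdeg]

end Quermass

section LayerCake

theorem volume_setOf_ofReal_le_inter_Ioi (c : ℝ≥0∞) :
    (volume : Measure ℝ) ({t | ENNReal.ofReal t ≤ c} ∩ Set.Ioi 0) = c := by
  rcases eq_or_ne c ∞ with rfl | hc
  · simp
  · have hIoc : {t : ℝ | ENNReal.ofReal t ≤ c} ∩ Set.Ioi 0 = Set.Ioc 0 c.toReal := by
      ext t
      simp [ENNReal.ofReal_le_iff_le_toReal hc, and_comm]
    rw [hIoc, Real.volume_Ioc, sub_zero, ENNReal.ofReal_toReal hc]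

theorem lintegral_eq_lintegral_meas_ofReal_le {α : Type*} [MeasurableSpace α] (μ : Measure α)
    [SFinite μ] {g : α → ℝ≥0∞} (hg : Measurable g) :
    ∫⁻ x, g x ∂μ = ∫⁻ t in Set.Ioi (0 : ℝ), μ {x | ENNReal.ofReal t ≤ g x} := by
  have hS : MeasurableSet {q : α × ℝ | ENNReal.ofReal q.2 ≤ g q.1} :=
    measurableSet_le (by fun_prop) (by fun_prop)
  calc ∫⁻ x, g x ∂μ
      = ∫⁻ x, volume.restrict (Set.Ioi 0) {t | ENNReal.ofReal t ≤ g x} ∂μ := by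
        refine lintegral_congr fun x => ?_
        rw [Measure.restrict_apply (measurableSet_le (by fun_prop) measurable_const),
          volume_setOf_ofReal_le_inter_Ioi]
    _ = (μ.prod (volume.restrict (Set.Ioi 0))) {q | ENNReal.ofReal q.2 ≤ g q.1} :=
        (Measure.prod_apply hS).symm
    _ = ∫⁻ t in Set.Ioi (0 : ℝ), μ {x | ENNReal.ofReal t ≤ g x} := Measure.prod_apply_symm hS

end LayerCake

section Superlevel

theorem isCompact_setOf_le_of_tendsto_cocompact {X α : Type*} [TopologicalSpace X] [LinearOrder α]
    [TopologicalSpace α] [OrderTopology α] {f : X → α} {a c : α} (hf : UpperSemicontinuous f)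
    (ha : Tendsto f (cocompact X) (𝓝 a)) (hac : a < c) : IsCompact {x | c ≤ f x} := by
  obtain ⟨t, ht, hts⟩ := mem_cocompact.mp (ha.eventually_lt_const hac)
  refine ht.of_isClosed_subset (hf.isClosed_preimage c) fun x hx => ?_
  by_contra hxt
  exact (Set.mem_ofPred_eq.mp (hts hxt)).not_ge hx

variable {n : ℕ} {f : EuclideanSpace ℝ (Fin n) → ℝ≥0∞}

theorem QClass.isCompact_setOf_ofReal_le (hf : QClass f) {t : ℝ} (ht : 0 < t) :
    IsCompact {x | ENNReal.ofReal t ≤ f x} :=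
  isCompact_setOf_le_of_tendsto_cocompact hf.upperSemicontinuous hf.vanishing
    (ENNReal.ofReal_pos.mpr ht)

theorem QClass.convex_setOf_le (hf : QClass f) (c : ℝ≥0∞) : Convex ℝ {x | c ≤ f x} := by
  simpa only [Set.mem_univ, true_and] using hf.quasiconcave c

theorem setOf_le_ballSup (hf : UpperSemicontinuous f) {ρ : ℝ} (hρ : 0 ≤ ρ) (c : ℝ≥0∞) :
    {x | c ≤ ballSup ρ f x} = {x | c ≤ f x} + ρ • closedBall 0 1 := by
  rw [smul_unitClosedBall_of_nonneg hρ]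
  ext x
  simp only [Set.mem_ofPred_eq, Set.mem_add]
  constructor
  · intro hx
    obtain ⟨y, hy, hmax⟩ := (hf.upperSemicontinuousOn (closedBall x ρ)).exists_isMaxOn
      ⟨x, mem_closedBall_self hρ⟩ (isCompact_closedBall x ρ)
    refine ⟨y, hx.trans (iSup₂_le fun z hz => hmax hz), x - y, ?_, add_sub_cancel y x⟩
    rwa [mem_closedBall_zero_iff, ← mem_closedBall_iff_norm']
  · rintro ⟨y, hy, z, hz, rfl⟩
    refine hy.trans (le_iSup₂_of_le y ?_ le_rfl)
    rwa [mem_closedBall_iff_norm', add_sub_cancel_left, ← mem_closedBall_zero_iff]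

theorem upperSemicontinuous_ballSup (hf : UpperSemicontinuous f) {ρ : ℝ} (hρ : 0 ≤ ρ) :
    UpperSemicontinuous (ballSup ρ f) := by
  refine upperSemicontinuous_iff_isClosed_preimage.mpr fun c => ?_
  change IsClosed {x | c ≤ ballSup ρ f x}
  rw [setOf_le_ballSup hf hρ]
  exact (hf.isClosed_preimage c).add_right_of_isCompact ((isCompact_closedBall 0 1).smul ρ)

theorem QClass.aemeasurable_quermass_setOf_ofReal_le (hf : QClass f) (i : Fin (n + 1)) :
    AEMeasurable (fun t : ℝ => quermass i {x | ENNReal.ofReal t ≤ f x})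
      (volume.restrict (Set.Ioi 0)) := by
  have hvol (j : ℕ) : Measurable fun t : ℝ =>
      volume.real ({x | ENNReal.ofReal t ≤ f x} + (j : ℝ) • closedBall 0 1) := by
    refine (Antitone.measurable fun s t hst => measure_mono ?_).ennreal_toReal
    exact Set.add_subset_add_right fun x hx => (ENNReal.ofReal_le_ofReal hst).trans hx
  have hsum : (fun t : ℝ => quermass i {x | ENNReal.ofReal t ≤ f x})
      =ᵐ[volume.restrict (Set.Ioi 0)] fun t => (∑ j ∈ Finset.range (n + 1),
        volume.real ({x | ENNReal.ofReal t ≤ f x} + (j : ℝ) • closedBall 0 1) *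
          lagrangeCoeff ℝ n i j) / n.choose i := by
    filter_upwards [ae_restrict_mem measurableSet_Ioi] with t ht
    exact quermass_eq_sum_volume (hf.isCompact_setOf_ofReal_le ht) (hf.convex_setOf_le _) i
  rw [aemeasurable_congr hsum]
  have hmeasurable := Finset.measurable_sum (Finset.range (n + 1)) fun j _ =>
    (hvol j).mul_const (lagrangeCoeff ℝ n i j)
  exact (hmeasurable.div_const _).aemeasurable

end Superlevel

end FunctionalSteiner

theorem theorem3p4 (n : ℕ) (hn : 1 ≤ n) (f : EuclideanSpace ℝ (Fin n) → ℝ≥0∞)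
    (hf : FunctionalSteiner.QClass f) (ρ : ℝ) (hρ : 0 < ρ) :
    ∫⁻ x, FunctionalSteiner.ballSup ρ f x =
      ∑ i : Fin (n + 1),
        (n.choose i : ℝ≥0∞) * FunctionalSteiner.functionalQuermass i f *
          ENNReal.ofReal ρ ^ (i : ℕ) := by
  have hquermass (i : Fin (n + 1)) :=
    (hf.aemeasurable_quermass_setOf_ofReal_le i).ennreal_ofReal
  calc ∫⁻ x, FunctionalSteiner.ballSup ρ f x
      = ∫⁻ t in Set.Ioi (0 : ℝ), volume {x | ENNReal.ofReal t ≤ FunctionalSteiner.ballSup ρ f x} :=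
        FunctionalSteiner.lintegral_eq_lintegral_meas_ofReal_le _
          (FunctionalSteiner.upperSemicontinuous_ballSup hf.upperSemicontinuous hρ.le).measurable
    _ = ∫⁻ t in Set.Ioi (0 : ℝ), ∑ i : Fin (n + 1), (n.choose i : ℝ≥0∞) *
          ENNReal.ofReal (FunctionalSteiner.quermass i {x | ENNReal.ofReal t ≤ f x}) *
            ENNReal.ofReal ρ ^ (i : ℕ) := by
        refine setLIntegral_congr_fun measurableSet_Ioi fun t ht => ?_
        rw [FunctionalSteiner.setOf_le_ballSup hf.upperSemicontinuous hρ.le,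
          FunctionalSteiner.volume_add_smul_closedBall_eq_sum (hf.isCompact_setOf_ofReal_le ht)
            (hf.convex_setOf_le _) hρ.le]
    _ = ∑ i : Fin (n + 1), (n.choose i : ℝ≥0∞) * FunctionalSteiner.functionalQuermass i f *
          ENNReal.ofReal ρ ^ (i : ℕ) := by
        rw [lintegral_finsetSum' _ fun i _ => ((hquermass i).const_mul _).mul_const _]
        refine Finset.sum_congr rfl fun i _ => ?_
        rw [lintegral_mul_const'' _ ((hquermass i).const_mul _),
          lintegral_const_mul'' _ (hquermass i), FunctionalSteiner.functionalQuermass]
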